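/- \textbf{Setting.} For $A\in\mathbb R^{n\times n}$ and $q\in\mathbb R^n$, LCP$(q,A)$ asks for $z\ge 0$ with $w=q+Az\ge 0$ and $z^Tw=0$. Let FEA$(q,A)=\{z\ge 0: q+Az\ge 0\}$ and SOL$(q,A)=\{z\in \mathrm{FEA}(q,A): z^T(q+Az)=0\}$. \textbf{Matrix classes.} $A$ is $E_0$ (respectively $E$) if for every $0\ne x\ge 0$ there is $i$ with $x_i>0$ and $(Ax)_i\ge 0$ (respectively $(Ax)_i>0$). $A$ is $E_0^s$ if $A\in E_0$ and $x\ge0$, $Ax\ge 0$, $x^TAx=0$ imply $A^Tx\le 0$. $A$ is $\tilde E_0^s$ if $A\in E_0^s$ and, for all $x\in\mathrm{SOL}(0,A)$ and all $i$, $(A^Tx)_i\neq 0$ implies $(Ax)_i\ne 0$. $A$ is completely $\tilde E_0^s$ if all its principal submatrices are $\tilde E_0^s$. $A$ is almost $E$ if all its principal submatrices of order $n-1$ are $E$ but $A$ is not. A legitimate principal pivot transform (PPT) of $A$ is, for some $\alpha\subseteq\{1,\dots,n\}$ with $\det A_{\alpha\alpha}\ne 0$ ($\alpha=\emptyset$ is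 allowed and gives $A$), the matrix $M$ with blocks $M_{\alpha\alpha}=A_{\alpha\alpha}^{-1}$, $M_{\alpha\bar\alpha}=-A_{\alpha\alpha}^{-1}A_{\alpha\bar\alpha}$, $M_{\bar\alpha\alpha}=A_{\bar\alpha\alpha}A_{\alpha\alpha}^{-1}$, $M_{\bar\alpha\bar\alpha}=A_{\bar\alpha\bar\alpha}-A_{\bar\alpha\alpha}A_{\alpha\alpha}^{-1}A_{\alpha\bar\alpha}$. \textbf{Lemke's algorithm.} Fix a covering vector $d\in\mathbb R^n$ with all $d_i>0$ and consider the system $w-Az-z_0d=q$, $w,z,z_0\ge 0$. If $q\ge 0$, stop with $z=0$. Otherwise start from the basis $w$, let $z_0$ replace the basic variable $w_r$ for the row $r$ at which $(q_i,e_i^T)/d_i$ is lexicographically least (with $e_i$ the $i$th unit vector), and let $z_r$ enter next. At each step, with basis matrix $B$ and entering column $a$, consider the rows $i$ with $(B^{-1}a)_i>0$. If there are none, stop on a ray. Otherwise choose the leaving variable by the minimum ratio test on $(B^{-1}q)_i/(B^{-1}a)_i$: it is $z_0$ if $z_0$ attains the minimum, and otherwise the basic variable of the row at which $\big((B^{-1}q)_i,(B^{-1})_{i\cdot}\big)/(B^{-1}a)_i$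 is lexicographically least. Pivot. If $z_0$ has left the basis, stop with the $z$-part of the new basic solution; otherwise the complement ($w_i\leftrightarrow z_i$) of the leaving variable enters next. The algorithm \emph{processes} LCP$(q,A)$ if, for every $d>0$, it stops after finitely many steps either with an element of SOL$(q,A)$ or on a ray, and in the latter case $\mathrm{FEA}(q,A)=\emptyset$. \textbf{Statement.} Let $A\in\mathbb R^{n\times n}$ be an $\tilde E_0^s$-matrix such that every legitimate PPT of $A$ is almost $E$ or completely $\tilde E_0^s$. Then, for every $q\in\mathbb R^n$, Lemke's algorithm processes LCP$(q,A)$. -/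

import Mathlib

namespace LCP

section MatrixClasses

variable {ι : Type*} [Fintype ι]

/-- Feasible set of `LCP(q, A)`: vectors `z ≥ 0` with `w = q + A z ≥ 0`. -/
def FEA (q : ι → ℝ) (A : Matrix ι ι ℝ) : Set (ι → ℝ) :=
  {z | 0 ≤ z ∧ 0 ≤ q + A.mulVec z}

/-- Solution set of `LCP(q, A)`: feasible `z` with `zᵀ (q + A z) = 0`. -/
def SOL (q : ι → ℝ) (A : Matrix ι ι ℝ) : Set (ι → ℝ) :=
  {z | z ∈ FEA q A ∧ z ⬝ᵥ (q + A.mulVec z) = 0}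

/-- Semimonotone matrices, the class `E₀`. -/
def IsSemimonotone (A : Matrix ι ι ℝ) : Prop :=
  ∀ x : ι → ℝ, 0 ≤ x → x ≠ 0 → ∃ i, 0 < x i ∧ 0 ≤ A.mulVec x i

/-- Strictly semimonotone matrices, the class `E`. -/
def IsStrictlySemimonotone (A : Matrix ι ι ℝ) : Prop :=
  ∀ x : ι → ℝ, 0 ≤ x → x ≠ 0 → ∃ i, 0 < x i ∧ 0 < A.mulVec x i

/-- Semimonotone star matrices, the class `E₀ˢ`. -/
def IsSemimonotoneStar (A : Matrix ι ι ℝ) : Prop :=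
  IsSemimonotone A ∧
    ∀ x : ι → ℝ, x ⬝ᵥ A.mulVec x = 0 → 0 ≤ A.mulVec x → 0 ≤ x → A.transpose.mulVec x ≤ 0

/-- The class `Ẽ₀ˢ`: matrices of `E₀ˢ` such that, for every `x ∈ SOL(0, A)` and every `i`,
`(Aᵀ x)ᵢ ≠ 0` implies `(A x)ᵢ ≠ 0`. -/
def IsSemimonotoneStarTilde (A : Matrix ι ι ℝ) : Prop :=
  IsSemimonotoneStar A ∧
    ∀ x ∈ SOL 0 A, ∀ i, A.transpose.mulVec x i ≠ 0 → A.mulVec x i ≠ 0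

/-- The principal submatrix `A_αα`. -/
def principalSubmatrix (A : Matrix ι ι ℝ) (α : Finset ι) :
    Matrix {i // i ∈ α} {i // i ∈ α} ℝ :=
  A.toBlock (fun i => i ∈ α) (fun i => i ∈ α)

/-- Completely `Ẽ₀ˢ`: all principal submatrices are in `Ẽ₀ˢ`. -/
def IsCompletelySemimonotoneStarTilde (A : Matrix ι ι ℝ) : Prop :=
  ∀ α : Finset ι, α.Nonempty → IsSemimonotoneStarTilde (principalSubmatrix A α)

/-- Almost `E`: every principal submatrix of order `n - 1` is in `E`, but the matrix itself
(of order `n`) is not. -/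
def IsAlmostStrictlySemimonotone (A : Matrix ι ι ℝ) : Prop :=
  (∀ α : Finset ι, α.card + 1 = Fintype.card ι →
    IsStrictlySemimonotone (principalSubmatrix A α)) ∧ ¬ IsStrictlySemimonotone A

/-- The principal pivot transform of `A` with respect to `α`
(meaningful when `det A_αα ≠ 0`). -/
noncomputable def ppt [DecidableEq ι] (A : Matrix ι ι ℝ) (α : Finset ι) : Matrix ι ι ℝ :=
  let Aaa := A.toBlock (fun i => i ∈ α) (fun i => i ∈ α)
  let Aab := A.toBlock (fun i => i ∈ α) (fun i => ¬ i ∈ α)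
  let Aba := A.toBlock (fun i => ¬ i ∈ α) (fun i => i ∈ α)
  let Abb := A.toBlock (fun i => ¬ i ∈ α) (fun i => ¬ i ∈ α)
  (Matrix.fromBlocks Aaa⁻¹ (-(Aaa⁻¹ * Aab)) (Aba * Aaa⁻¹) (Abb - Aba * Aaa⁻¹ * Aab)).submatrix
    (Equiv.sumCompl (fun i => i ∈ α)).symm (Equiv.sumCompl (fun i => i ∈ α)).symm

/-- `M` is a legitimate principal pivot transform of `A`: it is obtained by a principal pivot on
a nonsingular principal submatrix of `A` (`α = ∅` is allowed and gives `A` itself). -/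
def IsLegitimatePPT [DecidableEq ι] (A M : Matrix ι ι ℝ) : Prop :=
  ∃ α : Finset ι, (principalSubmatrix A α).det ≠ 0 ∧ M = ppt A α

end MatrixClasses

/-! Lemke's complementary pivot algorithm, with covering vector `d` and lexicographic resolution
of ties, on the augmented system `w - A z - z₀ d = q`, `w, z, z₀ ≥ 0`. -/

/-- The variables of the augmented system. -/
inductive LemkeVar (n : ℕ) : Type
  | z0 : LemkeVar n
  | w : Fin n → LemkeVar n
  | z : Fin n → LemkeVar n

namespace LemkeVar

/-- The complementary variable (`wᵢ` and `zᵢ` are complementary). -/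
def compl {n : ℕ} : LemkeVar n → LemkeVar n
  | z0 => z0
  | w i => z i
  | z i => w i

end LemkeVar

/-- A configuration of the algorithm: about to bring the variable `entering` into the basis
(`basis i` is the basic variable of row `i`), or stopped with a vector `z`, or stopped on a
secondary ray. -/
inductive LemkeConfig (n : ℕ) : Type
  | running (basis : Fin n → LemkeVar n) (entering : LemkeVar n) : LemkeConfig n
  | solved (z : Fin n → ℝ) : LemkeConfig n
  | ray : LemkeConfig n

namespace Lemke

variable {n : ℕ}

/-- The column of a variable in the system `w - A z - z₀ d = q`. -/
def column (A : Matrix (Fin n) (Fin n) ℝ) (d : Fin n → ℝ) : LemkeVar n → Fin n → ℝ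
  | .z0 => -d
  | .w i => Pi.single i 1
  | .z j => fun i => -A i j

/-- The basis matrix: column `j` is the column of the `j`-th basic variable. -/
def basisMatrix (A : Matrix (Fin n) (Fin n) ℝ) (d : Fin n → ℝ) (β : Fin n → LemkeVar n) :
    Matrix (Fin n) (Fin n) ℝ :=
  Matrix.of fun i j => column A d (β j) i

/-- The current values `B⁻¹ q` of the basic variables. -/
noncomputable def values (A : Matrix (Fin n) (Fin n) ℝ) (q d : Fin n → ℝ)
    (β : Fin n → LemkeVar n) : Fin n → ℝ :=
  (basisMatrix A d β)⁻¹.mulVec q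

/-- The rates `B⁻¹ aₑ` at which the basic variables decrease when the nonbasic variable `e`
increases. -/
noncomputable def rates (A : Matrix (Fin n) (Fin n) ℝ) (d : Fin n → ℝ)
    (β : Fin n → LemkeVar n) (e : LemkeVar n) : Fin n → ℝ :=
  (basisMatrix A d β)⁻¹.mulVec (column A d e)

/-- The rows of the basic variables that decrease when `e` increases. -/
noncomputable def candidates (A : Matrix (Fin n) (Fin n) ℝ) (d : Fin n → ℝ)
    (β : Fin n → LemkeVar n) (e : LemkeVar n) : Finset (Fin n) :=
  Finset.univ.filter fun i => 0 < rates A d β e i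

/-- The minimum ratio test without tie-breaking: `r` is a row in which a basic variable reaches
zero first when `e` increases. -/
def IsBlocking (A : Matrix (Fin n) (Fin n) ℝ) (q d : Fin n → ℝ)
    (β : Fin n → LemkeVar n) (e : LemkeVar n) (r : Fin n) : Prop :=
  r ∈ candidates A d β e ∧ ∀ i ∈ candidates A d β e,
    values A q d β r / rates A d β e r ≤ values A q d β i / rates A d β e i

/-- The ratio vector of row `i` in the lexicographic minimum ratio test: row `i` of `B⁻¹ [q, I]`
divided by the `i`-th rate. -/
noncomputable def lexRatio (A : Matrix (Fin n) (Fin n) ℝ) (q d : Fin n → ℝ)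
    (β : Fin n → LemkeVar n) (e : LemkeVar n) (i : Fin n) : Lex (Fin (n + 1) → ℝ) :=
  toLex (Fin.cons (values A q d β i / rates A d β e i)
    fun j => (basisMatrix A d β)⁻¹ i j / rates A d β e i)

/-- A row of `s` at which `f` is lexicographically least. -/
noncomputable def lexArgmin (s : Finset (Fin n)) (hs : s.Nonempty)
    (f : Fin n → Lex (Fin (n + 1) → ℝ)) : Fin n :=
  (s.exists_min_image f hs).choose

open Classical in
/-- The row of the leaving variable: the row of `z₀` if `z₀` is among the blocking variables,
and otherwise the row selected by the lexicographic minimum ratio test. -/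
noncomputable def leavingRow (A : Matrix (Fin n) (Fin n) ℝ) (q d : Fin n → ℝ)
    (β : Fin n → LemkeVar n) (e : LemkeVar n) (hs : (candidates A d β e).Nonempty) : Fin n :=
  if h : ∃ r, IsBlocking A q d β e r ∧ β r = LemkeVar.z0 then h.choose
  else lexArgmin (candidates A d β e) hs (lexRatio A q d β e)

open Classical in
/-- The `z`-part of the basic solution of the basis `β`. -/
noncomputable def zPart (A : Matrix (Fin n) (Fin n) ℝ) (q d : Fin n → ℝ)
    (β : Fin n → LemkeVar n) : Fin n → ℝ :=
  fun i => ∑ j, if β j = LemkeVar.z i then values A q d β j else 0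

open Classical in
/-- One step of the algorithm. If no basic variable blocks the increase of the entering variable,
stop on a ray. Otherwise pivot; if `z₀` has left the basis, stop and return the `z`-part of the
new basic solution, and if not, the complement of the leaving variable enters next. -/
noncomputable def step (A : Matrix (Fin n) (Fin n) ℝ) (q d : Fin n → ℝ) :
    LemkeConfig n → LemkeConfig n
  | .running β e =>
    if hs : (candidates A d β e).Nonempty then
      let r := leavingRow A q d β e hs
      if β r = LemkeVar.z0 then .solved (zPart A q d (Function.update β r e))
      else .running (Function.update β r e) (β r).compl
    else .ray
  | .solved z => .solved z
  | .ray => .ray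

theorem univ_nonempty_of_not_nonneg {q : Fin n → ℝ} (hq : ¬ 0 ≤ q) :
    (Finset.univ : Finset (Fin n)).Nonempty := by
  rw [Pi.le_def, not_forall] at hq
  exact ⟨hq.choose, Finset.mem_univ _⟩

open Classical in
/-- Initialization. If `q ≥ 0`, stop with `z = 0`. Otherwise `z₀` replaces the basic variable
`w_r` for the row `r` at which `[q, I]ᵢ / dᵢ` is lexicographically least, and `z_r` enters
next. -/
noncomputable def start (q d : Fin n → ℝ) : LemkeConfig n :=
  if hq : 0 ≤ q then .solved 0
  else
    let r := lexArgmin Finset.univ (univ_nonempty_of_not_nonneg hq) fun i =>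
      toLex (Fin.cons (q i / d i) fun j => (1 : Matrix (Fin n) (Fin n) ℝ) i j / d i)
    .running (Function.update LemkeVar.w r LemkeVar.z0) (LemkeVar.z r)

/-- Lemke's algorithm processes `LCP(q, A)`: for every positive covering vector it stops after
finitely many steps, either with a solution of `LCP(q, A)` or on a ray, and the latter only when
`LCP(q, A)` is infeasible. -/
def Processes (A : Matrix (Fin n) (Fin n) ℝ) (q : Fin n → ℝ) : Prop :=
  ∀ d : Fin n → ℝ, (∀ i, 0 < d i) → ∃ k : ℕ,
    (∃ z ∈ SOL q A, (step A q d)^[k] (start q d) = .solved z) ∨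
    ((step A q d)^[k] (start q d) = .ray ∧ FEA q A = ∅)

end Lemke

end LCP

/-! Two facts carry the proof: the path of Lemke's algorithm is finite, and a ray at its end
certifies infeasibility.

Finiteness is the usual reversibility argument. Carrying `[q, I]` instead of `q` as right-hand side
makes every basic row lexicographically positive, so a pivot is determined in both directions: given
a basis and an entering variable, at most one variable can leave so that the result is again
lexicographically feasible (`IsLexBasis.leaving_unique`). A repeated state can therefore be traced
backwards to the start, which has no predecessor (`IsPath.ne_of_lt`), and a path that came back to
the initial basis along the primary ray would be a palindrome, which is impossible at its midpoint
(`IsPath.not_reversed`). As there are finitely many states, the run stops.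

If it stops on a ray with direction `y`, let `u` be the `z`-part of `y`. If `u = 0`, the ray is the
primary one, already excluded. Otherwise semimonotonicity forces the `z₀`-part of `y` to vanish, so
`u` solves LCP(0, A). The star condition gives `Aᵀu ≤ 0`, and the tilde condition makes `Aᵀu`
orthogonal to the `z`-part of the current point; complementarity then yields `uᵀq < 0`. A feasible
`p` would give `0 ≤ uᵀ(q + Ap) ≤ uᵀq < 0` (`FEA_eq_empty_of_ray`). -/

namespace LCP

/-! ### Lexicographic positivity -/

section LexPos

variable {m : ℕ}

/-- Lexicographically positive vectors. -/
def LexPos (x : Fin m → ℝ) : Prop := 0 < toLex x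

theorem LexPos.smul {c : ℝ} {x : Fin m → ℝ} (hc : 0 < c) (hx : LexPos x) : LexPos (c • x) := by
  obtain ⟨i, hi, hxi⟩ := hx
  refine ⟨i, fun j hj => ?_, ?_⟩
  · have h : (0 : ℝ) = x j := hi j hj
    show (0 : ℝ) = c * x j
    rw [← h, mul_zero]
  · have h : (0 : ℝ) < x i := hxi
    show (0 : ℝ) < c * x i
    positivity

theorem LexPos.add {x y : Fin m → ℝ} (hx : LexPos x) (hy : LexPos y) : LexPos (x + y) :=
  add_pos (α := Lex (Fin m → ℝ)) hx hy

theorem not_lexPos_zero : ¬ LexPos (0 : Fin m → ℝ) := lt_irrefl (0 : Lex (Fin m → ℝ))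

theorem LexPos.not_neg {x : Fin m → ℝ} (hx : LexPos x) : ¬ LexPos (-x) := fun h =>
  not_lexPos_zero (add_neg_cancel x ▸ hx.add h)

theorem lexPos_sub {x y : Fin m → ℝ} : LexPos (y - x) ↔ toLex x < toLex y :=
  sub_pos (α := Lex (Fin m → ℝ))

theorem pos_of_lexPos_smul {c : ℝ} {x : Fin m → ℝ} (hx : LexPos x) (h : LexPos (c • x)) :
    0 < c := by
  rcases lt_trichotomy c 0 with hc | rfl | hc
  · have h' := hx.smul (neg_pos.2 hc)
    rw [neg_smul] at h'
    exact absurd h' h.not_neg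
  · rw [zero_smul] at h
    exact absurd h not_lexPos_zero
  · exact hc

theorem LexPos.zero_le {x : Fin (m + 1) → ℝ} (hx : LexPos x) : 0 ≤ x 0 := by
  obtain ⟨i, hi, hxi⟩ := hx
  rcases Fin.eq_zero_or_eq_succ i with rfl | ⟨j, rfl⟩
  · exact le_of_lt hxi
  · exact le_of_eq (hi 0 (Fin.succ_pos j))

theorem lexPos_of_zero_pos {x : Fin (m + 1) → ℝ} (hx : 0 < x 0) : LexPos x :=
  ⟨0, fun j hj => absurd hj (Fin.not_lt_zero j), hx⟩

end LexPos

namespace LemkeVar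

variable {n : ℕ}

/-- The variables as an option type over a sum. -/
def equivOption : LemkeVar n ≃ Option (Fin n ⊕ Fin n) where
  toFun
    | z0 => none
    | w i => some (.inl i)
    | z i => some (.inr i)
  invFun
    | none => z0
    | some (.inl i) => w i
    | some (.inr i) => z i
  left_inv := by rintro (_ | _ | _) <;> rfl
  right_inv := by rintro (_ | _ | _) <;> rfl

noncomputable instance : Fintype (LemkeVar n) := Fintype.ofEquiv _ equivOption.symm

theorem sum_eq (f : LemkeVar n → ℝ) : ∑ v, f v = f z0 + (∑ i, f (w i) + ∑ i, f (z i)) := by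
  rw [← Equiv.sum_comp equivOption.symm, Fintype.sum_option, Fintype.sum_sum_type]
  rfl

@[simp]
theorem compl_compl (v : LemkeVar n) : v.compl.compl = v := by cases v <;> rfl

theorem compl_eq_z0 {v : LemkeVar n} : v.compl = z0 ↔ v = z0 := by cases v <;> simp [compl]

theorem compl_ne_self {v : LemkeVar n} (hv : v ≠ z0) : v.compl ≠ v := by
  cases v <;> simp_all [compl]

end LemkeVar

/-! ### The augmented system and its tableaux -/

namespace Lemke

variable {n : ℕ} {A : Matrix (Fin n) (Fin n) ℝ} {q d : Fin n → ℝ}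

/-- The left-hand side `w - A z - z₀ d` of the augmented system. -/
def lhs (A : Matrix (Fin n) (Fin n) ℝ) (d : Fin n → ℝ) (x : LemkeVar n → ℝ) : Fin n → ℝ :=
  fun i => x (.w i) - A.mulVec (fun j => x (.z j)) i - d i * x .z0

theorem lhs_eq_sum (x : LemkeVar n → ℝ) (i : Fin n) :
    lhs A d x i = ∑ v, x v * column A d v i := by
  rw [LemkeVar.sum_eq]
  simp only [lhs, column, Pi.neg_apply, Pi.single_apply, mul_ite, mul_one, mul_zero,
    Finset.sum_ite_eq, Finset.mem_univ, if_true, Matrix.mulVec, dotProduct, mul_neg,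
    Finset.sum_neg_distrib]
  rw [Finset.sum_congr rfl fun j _ => mul_comm (A i j) _]
  ring

theorem lhs_sub (x y : LemkeVar n → ℝ) : lhs A d (x - y) = lhs A d x - lhs A d y := by
  ext i
  simp only [lhs_eq_sum, Pi.sub_apply, sub_mul, Finset.sum_sub_distrib]

theorem lhs_smul (c : ℝ) (x : LemkeVar n → ℝ) : lhs A d (c • x) = c • lhs A d x := by
  ext i
  simp only [lhs_eq_sum, Pi.smul_apply, smul_eq_mul, mul_assoc, Finset.mul_sum]

open Classical in
/-- The vector with value `y j` at the `j`-th basic variable and zero at the nonbasic ones. -/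
noncomputable def extend (β : Fin n → LemkeVar n) (y : Fin n → ℝ) : LemkeVar n → ℝ :=
  fun v => ∑ j, if β j = v then y j else 0

theorem zPart_eq (β : Fin n → LemkeVar n) :
    zPart A q d β = fun i => extend β (values A q d β) (.z i) := rfl

theorem lhs_extend (β : Fin n → LemkeVar n) (y : Fin n → ℝ) :
    lhs A d (extend β y) = (basisMatrix A d β).mulVec y := by
  classical
  ext i
  simp only [lhs_eq_sum, extend, Finset.sum_mul, Matrix.mulVec, dotProduct, basisMatrix,
    Matrix.of_apply]
  rw [Finset.sum_comm]
  refine Finset.sum_congr rfl fun j _ => ?_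
  simp [ite_mul, mul_comm]

theorem extend_apply {β : Fin n → LemkeVar n} (hβ : Function.Injective β) (y : Fin n → ℝ)
    (j : Fin n) : extend β y (β j) = y j := by
  classical
  simp [extend, hβ.eq_iff]

theorem extend_of_notMem {β : Fin n → LemkeVar n} (y : Fin n → ℝ) {v : LemkeVar n}
    (hv : v ∉ Set.range β) : extend β y v = 0 := by
  classical
  refine Finset.sum_eq_zero fun j _ => if_neg fun h => hv ⟨j, h⟩

theorem extend_nonneg {β : Fin n → LemkeVar n} {y : Fin n → ℝ} (hy : ∀ j, 0 ≤ y j)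
    (v : LemkeVar n) : 0 ≤ extend β y v := by
  classical
  refine Finset.sum_nonneg fun j _ => ?_
  split_ifs
  exacts [hy j, le_rfl]

/-- The right-hand side `[q, I]` of the system that the lexicographic rule works with. -/
def rhs (q : Fin n → ℝ) : Matrix (Fin n) (Fin (n + 1)) ℝ :=
  Matrix.of fun i => Fin.cons (q i) fun j => (1 : Matrix (Fin n) (Fin n) ℝ) i j

/-- The tableau `B⁻¹ [q, I]`. -/
noncomputable def tableau (A : Matrix (Fin n) (Fin n) ℝ) (q d : Fin n → ℝ)
    (β : Fin n → LemkeVar n) : Matrix (Fin n) (Fin (n + 1)) ℝ :=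
  Matrix.of fun i => Fin.cons (values A q d β i) fun j => (basisMatrix A d β)⁻¹ i j

theorem tableau_eq (β : Fin n → LemkeVar n) :
    tableau A q d β = (basisMatrix A d β)⁻¹ * rhs q := by
  ext i c
  refine Fin.cases ?_ (fun j => ?_) c
  · simp [tableau, rhs, Matrix.mul_apply, values, Matrix.mulVec, dotProduct]
  · simp [tableau, rhs, Matrix.mul_apply, Matrix.one_apply]

theorem basisMatrix_mul_tableau {β : Fin n → LemkeVar n} (h : IsUnit (basisMatrix A d β).det) :
    basisMatrix A d β * tableau A q d β = rhs q := by
  rw [tableau_eq, Matrix.mul_nonsing_inv_cancel_left _ _ h]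

/-- The last `n` columns of `[q, I]` form the identity, so the corresponding columns of `Y` are a
right inverse of the basis matrix. Exhibiting a candidate tableau thus settles nonsingularity as
well. -/
theorem isUnit_and_tableau_eq {β : Fin n → LemkeVar n} {Y : Matrix (Fin n) (Fin (n + 1)) ℝ}
    (h : basisMatrix A d β * Y = rhs q) :
    IsUnit (basisMatrix A d β).det ∧ tableau A q d β = Y := by
  have h1 : basisMatrix A d β * Y.submatrix id Fin.succ = 1 := by
    ext i j
    have := congrFun (congrFun h i) j.succ
    simpa [Matrix.mul_apply, rhs] using this
  have hu : IsUnit (basisMatrix A d β).det := Matrix.isUnit_det_of_right_inverse h1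
  refine ⟨hu, ?_⟩
  rw [tableau_eq, ← h, Matrix.nonsing_inv_mul_cancel_left _ _ hu]

theorem injective_of_isUnit {β : Fin n → LemkeVar n} (h : IsUnit (basisMatrix A d β).det) :
    Function.Injective β := by
  intro i j hij
  by_contra hne
  refine h.ne_zero (Matrix.det_zero_of_column_eq hne fun k => ?_)
  simp [basisMatrix, hij]

theorem lexRatio_eq (β : Fin n → LemkeVar n) (e : LemkeVar n) (i : Fin n) :
    lexRatio A q d β e i = toLex ((rates A d β e i)⁻¹ • tableau A q d β i) := by
  unfold lexRatio
  congr 1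
  ext c
  refine Fin.cases ?_ (fun j => ?_) c <;> simp [tableau, div_eq_inv_mul]

theorem lexArgmin_mem {s : Finset (Fin n)} (hs : s.Nonempty)
    (f : Fin n → Lex (Fin (n + 1) → ℝ)) : lexArgmin s hs f ∈ s :=
  (s.exists_min_image f hs).choose_spec.1

theorem lexArgmin_le {s : Finset (Fin n)} (hs : s.Nonempty)
    (f : Fin n → Lex (Fin (n + 1) → ℝ)) {i : Fin n} (hi : i ∈ s) : f (lexArgmin s hs f) ≤ f i :=
  (s.exists_min_image f hs).choose_spec.2 i hi

/-! ### Pivots and lexicographic feasibility -/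

/-- Lexicographically feasible bases. -/
def LexFeasible (A : Matrix (Fin n) (Fin n) ℝ) (q d : Fin n → ℝ) (β : Fin n → LemkeVar n) :
    Prop :=
  IsUnit (basisMatrix A d β).det ∧ ∀ j, LexPos (tableau A q d β j)

theorem basisMatrix_mulVec_rates {β : Fin n → LemkeVar n}
    (h : IsUnit (basisMatrix A d β).det) (e : LemkeVar n) :
    (basisMatrix A d β).mulVec (rates A d β e) = column A d e := by
  rw [rates, Matrix.mulVec_mulVec, Matrix.mul_nonsing_inv _ h, Matrix.one_mulVec]

/-- The tableau after a pivot in row `r`. -/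
noncomputable def pivot (A : Matrix (Fin n) (Fin n) ℝ) (q d : Fin n → ℝ)
    (β : Fin n → LemkeVar n) (e : LemkeVar n) (r : Fin n) : Matrix (Fin n) (Fin (n + 1)) ℝ :=
  Matrix.of fun i => if i = r then (rates A d β e r)⁻¹ • tableau A q d β r
    else tableau A q d β i - rates A d β e i • (rates A d β e r)⁻¹ • tableau A q d β r

theorem pivot_self (β : Fin n → LemkeVar n) (e : LemkeVar n) (r : Fin n) :
    pivot A q d β e r r = (rates A d β e r)⁻¹ • tableau A q d β r := if_pos rfl

theorem pivot_of_ne (β : Fin n → LemkeVar n) (e : LemkeVar n) {r i : Fin n} (h : i ≠ r) :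
    pivot A q d β e r i =
      tableau A q d β i - rates A d β e i • (rates A d β e r)⁻¹ • tableau A q d β r := if_neg h

theorem basisMatrix_update_mul_pivot {β : Fin n → LemkeVar n} {e : LemkeVar n} {r : Fin n}
    (h : IsUnit (basisMatrix A d β).det) (hr : rates A d β e r ≠ 0) :
    basisMatrix A d (Function.update β r e) * pivot A q d β e r = rhs q := by
  classical
  rw [← basisMatrix_mul_tableau h]
  ext i c
  have he := congrFun (basisMatrix_mulVec_rates h e) i
  simp only [Matrix.mulVec, dotProduct, basisMatrix, Matrix.of_apply] at he
  simp only [Matrix.mul_apply, basisMatrix, Matrix.of_apply, pivot]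
  rw [← Finset.add_sum_erase _ _ (Finset.mem_univ r)] at he ⊢
  rw [← Finset.add_sum_erase (Finset.univ) (fun j => column A d (β j) i * tableau A q d β j c)
    (Finset.mem_univ r)]
  have hsum : ∀ j ∈ Finset.univ.erase r,
      column A d (Function.update β r e j) i *
        (if j = r then (rates A d β e r)⁻¹ • tableau A q d β r
          else tableau A q d β j - rates A d β e j • (rates A d β e r)⁻¹ • tableau A q d β r) c =
      column A d (β j) i * tableau A q d β j c -
        (column A d (β j) i * rates A d β e j) * ((rates A d β e r)⁻¹ * tableau A q d β r c) := by
    intro j hj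
    have hjr := Finset.ne_of_mem_erase hj
    rw [Function.update_of_ne hjr, if_neg hjr]
    simp only [Pi.sub_apply, Pi.smul_apply, smul_eq_mul]
    ring
  rw [Finset.sum_congr rfl hsum, Finset.sum_sub_distrib, ← Finset.sum_mul,
    Function.update_self, if_pos rfl, ← he]
  simp only [Pi.smul_apply, smul_eq_mul]
  field_simp
  ring

theorem update_isUnit_and_tableau {β : Fin n → LemkeVar n} {e : LemkeVar n} {r : Fin n}
    (h : IsUnit (basisMatrix A d β).det) (hr : rates A d β e r ≠ 0) :
    IsUnit (basisMatrix A d (Function.update β r e)).det ∧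
      tableau A q d (Function.update β r e) = pivot A q d β e r :=
  isUnit_and_tableau_eq (basisMatrix_update_mul_pivot h hr)

/-- Rows of the invertible matrix `B⁻¹` are linearly independent. Hence the lexicographic ratio test
has no ties. -/
theorem tableau_smul_row_ne {β : Fin n → LemkeVar n} (h : IsUnit (basisMatrix A d β).det)
    {i j : Fin n} (hij : i ≠ j) {a b : ℝ} (ha : a ≠ 0) :
    a • tableau A q d β i ≠ b • tableau A q d β j := by
  intro he
  have hrow : ∀ k, a * (basisMatrix A d β)⁻¹ i k = b * (basisMatrix A d β)⁻¹ j k := fun k => by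
    simpa [tableau] using congrFun he k.succ
  have hcol : ∀ l, a * (1 : Matrix (Fin n) (Fin n) ℝ) i l = b * (1 : Matrix _ _ ℝ) j l := by
    intro l
    rw [← Matrix.nonsing_inv_mul _ h, Matrix.mul_apply, Matrix.mul_apply, Finset.mul_sum,
      Finset.mul_sum]
    exact Finset.sum_congr rfl fun k _ => by rw [← mul_assoc, hrow, mul_assoc]
  have := hcol i
  rw [Matrix.one_apply_eq, Matrix.one_apply_ne hij.symm] at this
  simp [ha] at this

/-- Rows with nonpositive rate gain a nonnegative multiple of a positive row; for the others, the
strict minimality of the pivot ratio is exactly positivity of the new row. -/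
theorem LexFeasible.update {β : Fin n → LemkeVar n} {e : LemkeVar n}
    (hβ : LexFeasible A q d β) (hs : (candidates A d β e).Nonempty) :
    LexFeasible A q d
      (Function.update β (lexArgmin (candidates A d β e) hs (lexRatio A q d β e)) e) := by
  set r := lexArgmin (candidates A d β e) hs (lexRatio A q d β e)
  have hr : 0 < rates A d β e r :=
    (Finset.mem_filter.1 (lexArgmin_mem hs (lexRatio A q d β e))).2
  obtain ⟨hu, ht⟩ := update_isUnit_and_tableau (q := q) hβ.1 hr.ne'
  refine ⟨hu, fun i => ?_⟩
  rw [ht]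
  have hpr : LexPos ((rates A d β e r)⁻¹ • tableau A q d β r) := (hβ.2 r).smul (inv_pos.2 hr)
  by_cases hir : i = r
  · rw [hir, pivot_self]
    exact hpr
  · rw [pivot_of_ne _ _ hir]
    rcases le_or_gt (rates A d β e i) 0 with hi | hi
    · rcases hi.eq_or_lt with h0 | h0
      · rw [h0, zero_smul, sub_zero]
        exact hβ.2 i
      · rw [sub_eq_add_neg, ← neg_smul]
        exact (hβ.2 i).add (hpr.smul (neg_pos.2 h0))
    · have hle : lexRatio A q d β e r ≤ lexRatio A q d β e i :=
        lexArgmin_le hs _ (Finset.mem_filter.2 ⟨Finset.mem_univ i, hi⟩)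
      have hne : lexRatio A q d β e r ≠ lexRatio A q d β e i := by
        rw [lexRatio_eq, lexRatio_eq]
        intro h
        exact tableau_smul_row_ne hβ.1 (Ne.symm hir) (inv_ne_zero hr.ne') (toLex.injective h)
      have hlt := lt_of_le_of_ne hle hne
      rw [lexRatio_eq, lexRatio_eq] at hlt
      have := (lexPos_sub.2 hlt).smul hi
      rwa [smul_sub, smul_inv_smul₀ hi.ne'] at this

/-! ### Uniqueness of the leaving variable and of the initial basis -/

/-- Lexicographically feasible bases as sets of variables. -/
def IsLexBasis (A : Matrix (Fin n) (Fin n) ℝ) (q d : Fin n → ℝ) (S : Set (LemkeVar n)) : Prop :=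
  (∀ x : LemkeVar n → ℝ, lhs A d x = 0 → (∀ v ∉ S, x v = 0) → x = 0) ∧
    ∃ X : LemkeVar n → Fin (n + 1) → ℝ, (∀ c i, lhs A d (fun v => X v c) i = rhs q i c) ∧
      (∀ v ∉ S, X v = 0) ∧ ∀ v ∈ S, LexPos (X v)

theorem LexFeasible.isLexBasis {β : Fin n → LemkeVar n} (h : LexFeasible A q d β) :
    IsLexBasis A q d (Set.range β) := by
  have hinj := injective_of_isUnit h.1
  refine ⟨fun x hx hx0 => ?_, fun v c => extend β (fun j => tableau A q d β j c) v, ?_, ?_, ?_⟩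
  · have hxe : x = extend β (fun j => x (β j)) := by
      ext v
      by_cases hv : v ∈ Set.range β
      · obtain ⟨j, rfl⟩ := hv
        rw [extend_apply hinj]
      · rw [hx0 v hv, extend_of_notMem _ hv]
    rw [hxe, lhs_extend] at hx
    have h0 : (fun j => x (β j)) = 0 :=
      Matrix.eq_zero_of_mulVec_eq_zero h.1.ne_zero hx
    ext v
    by_cases hv : v ∈ Set.range β
    · obtain ⟨j, rfl⟩ := hv
      exact congrFun h0 j
    · exact hx0 v hv
  · intro c i
    rw [lhs_extend, ← basisMatrix_mul_tableau h.1]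
    rfl
  · intro v hv
    ext c
    exact extend_of_notMem _ hv
  · rintro _ ⟨j, rfl⟩
    have hj := h.2 j
    have heq : tableau A q d β j = fun c => extend β (fun j => tableau A q d β j c) (β j) :=
      funext fun c => (extend_apply hinj (fun j => tableau A q d β j c) j).symm
    rw [heq] at hj
    exact hj

/-- At most one basic variable can leave a lexicographically feasible basis when `e` enters. -/
theorem IsLexBasis.leaving_unique {S : Set (LemkeVar n)} {e a b : LemkeVar n}
    (hS : IsLexBasis A q d S) (he : e ∉ S) (ha : a ∈ S) (hb : b ∈ S)
    (hSa : IsLexBasis A q d (insert e (S \ {a}))) (hSb : IsLexBasis A q d (insert e (S \ {b}))) :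
    a = b := by
  by_contra hab
  obtain ⟨hind, X, hX, hX0, hXpos⟩ := hS
  obtain ⟨-, Y, hY, hY0, hYpos⟩ := hSa
  obtain ⟨-, Z, hZ, hZ0, hZpos⟩ := hSb
  have hea : a ≠ e := fun h => he (h ▸ ha)
  have heb : b ≠ e := fun h => he (h ▸ hb)
  have hYe := hYpos e (Set.mem_insert _ _)
  have hZe := hZpos e (Set.mem_insert _ _)
  obtain ⟨c, hc⟩ : ∃ c, Y e c ≠ 0 := by
    by_contra! h
    have h0 : Y e = 0 := funext h
    rw [h0] at hYe
    exact not_lexPos_zero hYe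
  have hker : ∀ {P Q : LemkeVar n → Fin (n + 1) → ℝ},
      (∀ c i, lhs A d (fun v => P v c) i = rhs q i c) →
      (∀ c i, lhs A d (fun v => Q v c) i = rhs q i c) →
      ∀ c, lhs A d ((fun v => P v c) - fun v => Q v c) = 0 := by
    intro P Q hP hQ c
    rw [lhs_sub]
    ext i
    simp [hP, hQ]
  -- `κ` spans the kernel directions supported on `S ∪ {e}`, normalized at `e`; it is read off from
  -- a column where `Y e` is nonzero. Every solution supported there is then `X` plus a multiple of
  -- `κ` in each column.
  obtain ⟨κ, hκ, hκe, hκ0⟩ : ∃ κ : LemkeVar n → ℝ, lhs A d κ = 0 ∧ κ e = 1 ∧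
      ∀ v ∉ S, v ≠ e → κ v = 0 := by
    refine ⟨(Y e c)⁻¹ • ((fun v => Y v c) - fun v => X v c), ?_, ?_, ?_⟩
    · rw [lhs_smul, hker hY hX, smul_zero]
    · simp [hX0 e he, hc]
    · intro v hv hve
      have : v ∉ insert e (S \ {a}) := by
        rintro (h | h)
        exacts [hve h, hv h.1]
      simp [hX0 v hv, hY0 v this]
  have hprop : ∀ {P : LemkeVar n → Fin (n + 1) → ℝ},
      (∀ c i, lhs A d (fun v => P v c) i = rhs q i c) → (∀ v ∉ S, v ≠ e → P v = 0) →
      ∀ v, P v - X v = κ v • P e := by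
    intro P hP hP0 v
    ext c
    have h0 : ((fun v => P v c) - fun v => X v c) - P e c • κ = 0 := by
      refine hind _ ?_ fun v hv => ?_
      · rw [lhs_sub, hker hP hX, lhs_smul, hκ, smul_zero, sub_zero]
      · by_cases hve : v = e
        · subst hve
          simp [hX0 v hv, hκe]
        · simp [hX0 v hv, hP0 v hv hve, hκ0 v hv hve]
    have := congrFun h0 v
    simp only [Pi.sub_apply, Pi.smul_apply, smul_eq_mul, Pi.zero_apply] at this ⊢
    linarith
  have hYv := hprop hY fun v hv hve => hY0 v (by
    rintro (h | h)
    exacts [hve h, hv h.1])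
  have hZv := hprop hZ fun v hv hve => hZ0 v (by
    rintro (h | h)
    exacts [hve h, hv h.1])
  have hYa : Y a = 0 := hY0 a (by
    rintro (h | h)
    exacts [hea h, h.2 rfl])
  have hZb : Z b = 0 := hZ0 b (by
    rintro (h | h)
    exacts [heb h, h.2 rfl])
  have hYb := hYpos b (Or.inr ⟨hb, fun h => hab h.symm⟩)
  have hZa := hZpos a (Or.inr ⟨ha, hab⟩)
  have h1 := hYv a
  have h2 := hZv b
  have h3 := hYv b
  have h4 := hZv a
  rw [hYa, zero_sub] at h1
  rw [hZb, zero_sub] at h2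
  have hκa : 0 < -κ a := pos_of_lexPos_smul hYe (by
    rw [neg_smul, ← h1, neg_neg]
    exact hXpos a ha)
  have hκb : 0 < -κ b := pos_of_lexPos_smul hZe (by
    rw [neg_smul, ← h2, neg_neg]
    exact hXpos b hb)
  -- With `-κ a` and `-κ b` positive, `Z a` and `Y b` force `Y e - Z e` and its negative to be both
  -- lexicographically positive.
  have e1 : Z a = (-κ a) • (Y e - Z e) := by
    rw [smul_sub, neg_smul, neg_smul, ← h1, ← h4]
    abel
  have e2 : Y b = (-κ b) • (Z e - Y e) := by
    rw [smul_sub, neg_smul, neg_smul, ← h2, ← h3]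
    abel
  have p1 : LexPos (Y e - Z e) := by
    have := hZa.smul (inv_pos.2 hκa)
    rwa [e1, inv_smul_smul₀ hκa.ne'] at this
  have p2 : LexPos (Z e - Y e) := by
    have := hYb.smul (inv_pos.2 hκb)
    rwa [e2, inv_smul_smul₀ hκb.ne'] at this
  exact p1.not_neg (by rwa [neg_sub])

/-- The basis in which `z₀` has replaced `w_r`. -/
def initialBasis (r : Fin n) : Set (LemkeVar n) := insert .z0 (LemkeVar.w '' {r}ᶜ)

theorem w_mem_initialBasis {i r : Fin n} : LemkeVar.w i ∈ initialBasis r ↔ i ≠ r := by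
  simp [initialBasis]

theorem z_notMem_initialBasis {i r : Fin n} : LemkeVar.z i ∉ initialBasis r := by
  simp [initialBasis]

/-- With the `z`-variables zero, row `i` reads `wᵢ - dᵢ z₀ = rhs`. Comparing two such bases in the
rows `r` and `s` makes the difference of their `z₀`-values positive with both signs. -/
theorem initialBasis_unique (hd : ∀ i, 0 < d i) {r s : Fin n}
    (hr : IsLexBasis A q d (initialBasis r)) (hs : IsLexBasis A q d (initialBasis s)) : r = s := by
  by_contra hrs
  obtain ⟨-, X, hX, hX0, hXpos⟩ := hr
  obtain ⟨-, Y, hY, hY0, hYpos⟩ := hs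
  have key : ∀ {P : LemkeVar n → Fin (n + 1) → ℝ} {t : Fin n},
      (∀ c i, lhs A d (fun v => P v c) i = rhs q i c) → (∀ v ∉ initialBasis t, P v = 0) →
      ∀ i, P (.w i) - d i • P .z0 = rhs q i := by
    intro P t hP hP0 i
    ext c
    rw [← hP c i]
    have hz : (fun j => P (.z j) c) = 0 := by
      ext j
      rw [hP0 _ z_notMem_initialBasis]
      rfl
    simp [lhs, hz]
  have hw0 : ∀ t : Fin n, LemkeVar.w t ∉ initialBasis t := fun t h => w_mem_initialBasis.1 h rfl
  have h1 := (key hX hX0 r).trans (key hY hY0 r).symm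
  have h2 := (key hX hX0 s).trans (key hY hY0 s).symm
  rw [hX0 _ (hw0 r)] at h1
  rw [hY0 _ (hw0 s)] at h2
  have e1 : Y (.w r) = d r • (Y .z0 - X .z0) := by
    rw [smul_sub]
    exact (sub_eq_iff_eq_add.1 h1.symm).trans (by abel)
  have e2 : X (.w s) = d s • (X .z0 - Y .z0) := by
    rw [smul_sub]
    exact (sub_eq_iff_eq_add.1 h2).trans (by abel)
  have p1 : LexPos (Y .z0 - X .z0) := by
    have := (hYpos _ (w_mem_initialBasis.2 hrs)).smul (inv_pos.2 (hd r))
    rwa [e1, inv_smul_smul₀ (hd r).ne'] at this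
  have p2 : LexPos (X .z0 - Y .z0) := by
    have := (hXpos _ (w_mem_initialBasis.2 (Ne.symm hrs))).smul (inv_pos.2 (hd s))
    rwa [e2, inv_smul_smul₀ (hd s).ne'] at this
  exact p1.not_neg (by rwa [neg_sub])

/-! ### The path neither repeats nor reverses -/

/-- The invariants of a running configuration. -/
structure Valid (A : Matrix (Fin n) (Fin n) ℝ) (q d : Fin n → ℝ) (β : Fin n → LemkeVar n)
    (e : LemkeVar n) : Prop where
  lexFeasible : LexFeasible A q d β
  z0_mem : LemkeVar.z0 ∈ Set.range β
  values_pos : ∀ j, β j = .z0 → 0 < values A q d β j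
  entering_ne : e ≠ .z0
  entering_notMem : e ∉ Set.range β
  compl_notMem : e.compl ∉ Set.range β
  compl_mem : ∀ v ∈ Set.range β, v ≠ .z0 → v.compl ∉ Set.range β

/-- The changes of the basis and of the entering variable in one step. -/
structure Pivots (S : Set (LemkeVar n)) (e : LemkeVar n) (S' : Set (LemkeVar n))
    (e' : LemkeVar n) : Prop where
  leaving_mem : e'.compl ∈ S
  eq : S' = insert e (S \ {e'.compl})

/-- The same pivot run backwards, with the old leaving variable entering; this lets
`IsLexBasis.leaving_unique` determine predecessors. -/
theorem Pivots.eq_insert {S S' : Set (LemkeVar n)} {e e' : LemkeVar n} (h : Pivots S e S' e')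
    (he : e ∉ S) : S = insert e'.compl (S' \ {e}) := by
  rw [h.eq, Set.insert_sdiff_self_of_notMem fun h' => he h'.1, Set.insert_sdiff_singleton,
    Set.insert_eq_of_mem h.leaving_mem]

theorem Pivots.entering_mem {S S' : Set (LemkeVar n)} {e e' : LemkeVar n}
    (h : Pivots S e S' e') : e ∈ S' := h.eq ▸ Set.mem_insert _ _

/-- A sequence of `m` steps from the start of the algorithm. -/
structure IsPath (A : Matrix (Fin n) (Fin n) ℝ) (q d : Fin n → ℝ) (r : Fin n)
    (β : ℕ → Fin n → LemkeVar n) (e : ℕ → LemkeVar n) (m : ℕ) : Prop where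
  range_zero : Set.range (β 0) = initialBasis r
  entering_zero : e 0 = .z r
  valid : ∀ k ≤ m, Valid A q d (β k) (e k)
  pivots : ∀ k < m, Pivots (Set.range (β k)) (e k) (Set.range (β (k + 1))) (e (k + 1))

theorem IsPath.ne_of_lt (hd : ∀ i, 0 < d i) {r : Fin n} {β : ℕ → Fin n → LemkeVar n}
    {e : ℕ → LemkeVar n} {m : ℕ} (h : IsPath A q d r β e m) {i j : ℕ} (hij : i < j) (hj : j ≤ m)
    (hβ : Set.range (β i) = Set.range (β j)) : e i ≠ e j := by
  induction i generalizing j with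
  | zero =>
    intro he
    obtain ⟨p, rfl⟩ := Nat.exists_eq_succ_of_ne_zero hij.ne'
    have hp := h.pivots p hj
    have hv := h.valid p (by omega)
    have hS := hp.eq_insert hv.entering_notMem
    have hmem := hp.entering_mem
    rw [← hβ, h.range_zero] at hS hmem
    rw [← he, h.entering_zero] at hS
    rcases hmem with h0 | ⟨i, hi, hw⟩
    · exact hv.entering_ne h0
    -- A predecessor of the start would bring back `w r` in place of some `w i`, and so would be
    -- another initial basis.
    · have hS' : Set.range (β p) = initialBasis i := by
        rw [hS, ← hw]
        ext v
        rcases v with _ | k | k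
        · simp [initialBasis, LemkeVar.compl]
        · simp only [LemkeVar.compl, Set.mem_insert_iff, LemkeVar.w.injEq, Set.mem_sdiff,
            Set.mem_singleton_iff, w_mem_initialBasis]
          have : i ≠ r := hi
          grind
        · simp [initialBasis, LemkeVar.compl]
      have h1 := hv.lexFeasible.isLexBasis
      have h2 := (h.valid 0 (by omega)).lexFeasible.isLexBasis
      rw [hS'] at h1
      rw [h.range_zero] at h2
      exact hi (initialBasis_unique hd h1 h2)
  | succ i ih =>
    intro he
    obtain ⟨p, rfl⟩ := Nat.exists_eq_succ_of_ne_zero (Nat.ne_zero_of_lt hij)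
    have hpi := h.pivots i (by omega)
    have hpp := h.pivots p hj
    have hvi := h.valid i (by omega)
    have hvp := h.valid p (by omega)
    have hS1 := hpi.eq_insert hvi.entering_notMem
    have hS2 := hpp.eq_insert hvp.entering_notMem
    have hm1 := hpi.entering_mem
    have hm2 := hpp.entering_mem
    have hv := h.valid (i + 1) (by omega)
    rw [← hβ, ← he] at hS2
    rw [← hβ] at hm2
    -- Equal states have equal predecessors, so the coincidence moves one step back on both sides.
    have heq : e i = e p := hv.lexFeasible.isLexBasis.leaving_unique hv.compl_notMem hm1 hm2
      (hS1 ▸ hvi.lexFeasible.isLexBasis) (hS2 ▸ hvp.lexFeasible.isLexBasis)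
    exact ih (j := p) (by omega) (by omega) (by rw [hS1, hS2, heq]) heq

theorem IsPath.not_reversed {r : Fin n} {β : ℕ → Fin n → LemkeVar n}
    {e : ℕ → LemkeVar n} {m : ℕ} (h : IsPath A q d r β e m)
    (hβ : Set.range (β m) = Set.range (β 0)) (he : e m = (e 0).compl) : False := by
  -- The path is a palindrome: the backward pivot from step `m - j` has the same basis and entering
  -- variable as the forward pivot from step `j`.
  have key : ∀ j ≤ m, Set.range (β (m - j)) = Set.range (β j) ∧ e (m - j) = (e j).compl := by
    intro j
    induction j with
    | zero => exact fun _ => ⟨hβ, he⟩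
    | succ j ih =>
      intro hj
      obtain ⟨ih1, ih2⟩ := ih (by omega)
      obtain ⟨p, hp⟩ : ∃ p, m - j = p + 1 := ⟨m - j - 1, by omega⟩
      have hp' : m - (j + 1) = p := by omega
      rw [hp] at ih1 ih2
      rw [hp']
      have hpj := h.pivots j (by omega)
      have hpp := h.pivots p (by omega)
      have hvp := h.valid p (by omega)
      have hvj := h.valid j (by omega)
      have hS := hpp.eq_insert hvp.entering_notMem
      have hm := hpp.entering_mem
      rw [ih1, ih2, LemkeVar.compl_compl] at hS
      rw [ih1] at hm
      have heq : e p = (e (j + 1)).compl :=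
        hvj.lexFeasible.isLexBasis.leaving_unique hvj.entering_notMem hm hpj.leaving_mem
          (hS ▸ hvp.lexFeasible.isLexBasis)
          (hpj.eq ▸ (h.valid (j + 1) (by omega)).lexFeasible.isLexBasis)
      exact ⟨by rw [hS, hpj.eq, heq], heq⟩
  -- At the midpoint, an even length makes a variable its own complement, and an odd length makes a
  -- pivot leave the basis unchanged.
  rcases Nat.even_or_odd' m with ⟨k, hk | hk⟩
  · have := (key k (by omega)).2
    rw [show m - k = k by omega] at this
    exact LemkeVar.compl_ne_self (h.valid k (by omega)).entering_ne this.symm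
  · have := (key k (by omega)).1
    rw [show m - k = k + 1 by omega] at this
    exact (h.valid k (by omega)).entering_notMem
      (this ▸ (h.pivots k (by omega)).entering_mem)

/-! ### Initialization and single steps -/

theorem zero_le_of_toLex_le {m : ℕ} {x y : Fin (m + 1) → ℝ} (h : toLex x ≤ toLex y) :
    x 0 ≤ y 0 := Pi.apply_le_of_toLex h fun j hj => absurd hj (Fin.not_lt_zero j)

theorem tableau_zero (β : Fin n → LemkeVar n) (i : Fin n) :
    tableau A q d β i 0 = values A q d β i := rfl

theorem range_update {β : Fin n → LemkeVar n} (hβ : Function.Injective β) (r : Fin n)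
    (e : LemkeVar n) : Set.range (Function.update β r e) = insert e (Set.range β \ {β r}) := by
  ext v
  constructor
  · rintro ⟨j, rfl⟩
    by_cases hj : j = r
    · subst hj
      simp
    · rw [Function.update_of_ne hj]
      exact Or.inr ⟨⟨j, rfl⟩, fun h => hj (hβ h)⟩
  · rintro (rfl | ⟨⟨j, rfl⟩, hj⟩)
    · exact ⟨r, Function.update_self ..⟩
    · exact ⟨j, Function.update_of_ne (fun h => hj (congrArg β h)) _ _⟩

theorem basisMatrix_w : basisMatrix A d LemkeVar.w = 1 := by
  ext i j
  simp [basisMatrix, column, Matrix.one_apply, Pi.single_apply]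

theorem rates_w (e : LemkeVar n) : rates A d LemkeVar.w e = column A d e := by
  simp [rates, basisMatrix_w]

theorem tableau_w : tableau A q d LemkeVar.w = rhs q := by
  simp [tableau_eq, basisMatrix_w]

/-- The first exchange is a pivot with negative rates `-dᵢ`. Lexicographic minimality of row `r`
makes the other rows positive, and `q r < 0` gives `z₀` a positive value. -/
theorem start_spec (A : Matrix (Fin n) (Fin n) ℝ) (hd : ∀ i, 0 < d i) (hq : ¬ 0 ≤ q) :
    ∃ r β, start q d = .running β (.z r) ∧ Set.range β = initialBasis r ∧
      Valid A q d β (.z r) := by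
  set f : Fin n → Lex (Fin (n + 1) → ℝ) := fun i =>
    toLex (Fin.cons (q i / d i) fun j => (1 : Matrix (Fin n) (Fin n) ℝ) i j / d i) with hf
  have hfi : ∀ i, f i = toLex ((d i)⁻¹ • rhs q i) := by
    intro i
    simp only [hf]
    congr 1
    ext c
    refine Fin.cases ?_ (fun j => ?_) c <;> simp [rhs, div_eq_inv_mul]
  set r := lexArgmin Finset.univ (univ_nonempty_of_not_nonneg hq) f with hr
  have hle : ∀ i, f r ≤ f i := fun i => lexArgmin_le _ f (Finset.mem_univ i)
  have hqr : q r < 0 := by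
    rw [Pi.le_def, not_forall] at hq
    obtain ⟨i, hi⟩ := hq
    have hi : q i < 0 := not_le.1 hi
    have h0 : q r / d r ≤ q i / d i := zero_le_of_toLex_le (hle i)
    by_contra h
    have h1 : 0 ≤ q r / d r := div_nonneg (not_lt.1 h) (hd r).le
    exact absurd (h1.trans h0) (not_le.2 (div_neg_of_neg_of_pos hi (hd i)))
  have hw : IsUnit (basisMatrix A d LemkeVar.w).det := by simp [basisMatrix_w]
  have hrate : ∀ i, rates A d LemkeVar.w .z0 i = -d i := fun i => by rw [rates_w]; rfl
  obtain ⟨hu, ht⟩ := update_isUnit_and_tableau (A := A) (q := q) (e := .z0) (r := r) hw (by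
    rw [hrate]
    exact (neg_neg_of_pos (hd r)).ne)
  have hrow : tableau A q d (Function.update LemkeVar.w r .z0) r = -((d r)⁻¹ • rhs q r) := by
    rw [ht, pivot_self, hrate, tableau_w, inv_neg, neg_smul]
  have hrow0 : 0 < tableau A q d (Function.update LemkeVar.w r .z0) r 0 := by
    rw [hrow]
    show 0 < -((d r)⁻¹ * q r)
    rw [← mul_neg]
    exact mul_pos (inv_pos.2 (hd r)) (neg_pos.2 hqr)
  have hrange : Set.range (Function.update LemkeVar.w r .z0) = initialBasis r := by
    rw [range_update (fun i j h => LemkeVar.w.inj h)]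
    ext v
    rcases v with _ | k | k <;> simp [initialBasis]
  refine ⟨r, Function.update LemkeVar.w r .z0, ?_, hrange, ?_⟩
  · rw [start, dif_neg hq]
  · refine ⟨⟨hu, fun i => ?_⟩, ?_, fun j hj => ?_, by simp, ?_, ?_, ?_⟩
    · by_cases hir : i = r
      · rw [hir]
        exact lexPos_of_zero_pos hrow0
      · have hlt : f r < f i := by
          refine lt_of_le_of_ne (hle i) ?_
          rw [hfi, hfi]
          intro h
          have := tableau_smul_row_ne (q := q) hw (Ne.symm hir) (b := (d i)⁻¹)
            (inv_ne_zero (hd r).ne')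
          rw [tableau_w] at this
          exact this (toLex.injective h)
        rw [hfi, hfi] at hlt
        have := (lexPos_sub.2 hlt).smul (hd i)
        rw [smul_sub, smul_inv_smul₀ (hd i).ne'] at this
        rwa [ht, pivot_of_ne _ _ hir, hrate, hrate, tableau_w, inv_neg, neg_smul, neg_smul,
          smul_neg, neg_neg]
    · rw [hrange]
      exact Set.mem_insert _ _
    · have hjr : j = r := by
        by_contra h
        simp [Function.update_of_ne h] at hj
      rw [← tableau_zero, hjr]
      exact hrow0
    · rw [hrange]
      exact z_notMem_initialBasis
    · rw [hrange]
      exact fun h => w_mem_initialBasis.1 h rfl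
    · rw [hrange]
      rintro (_ | k | k) hv hv0
      exacts [absurd rfl hv0, z_notMem_initialBasis, absurd hv z_notMem_initialBasis]

theorem isBlocking_lexArgmin {β : Fin n → LemkeVar n} {e : LemkeVar n}
    (hs : (candidates A d β e).Nonempty) :
    IsBlocking A q d β e (lexArgmin (candidates A d β e) hs (lexRatio A q d β e)) :=
  ⟨lexArgmin_mem hs _, fun _ hi => zero_le_of_toLex_le (lexArgmin_le hs (lexRatio A q d β e) hi)⟩

/-- Only the ordinary ratio test is assumed, because the preference for `z₀` may override the
lexicographic choice in the last pivot. -/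
theorem values_update_nonneg {β : Fin n → LemkeVar n} {e : LemkeVar n} {r : Fin n}
    (hβ : LexFeasible A q d β) (hr : IsBlocking A q d β e r) (i : Fin n) :
    0 ≤ values A q d (Function.update β r e) i := by
  have hrr : 0 < rates A d β e r := (Finset.mem_filter.1 hr.1).2
  have hv : ∀ i, 0 ≤ values A q d β i := fun i => (hβ.2 i).zero_le
  rw [← tableau_zero, (update_isUnit_and_tableau hβ.1 hrr.ne').2]
  by_cases hir : i = r
  · rw [hir, pivot_self]
    exact mul_nonneg (inv_nonneg.2 hrr.le) (hv r)
  · rw [pivot_of_ne _ _ hir]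
    show 0 ≤ values A q d β i - rates A d β e i * ((rates A d β e r)⁻¹ * values A q d β r)
    rw [← div_eq_inv_mul]
    have hθ : 0 ≤ values A q d β r / rates A d β e r := div_nonneg (hv r) hrr.le
    rcases le_or_gt (rates A d β e i) 0 with hi | hi
    · linarith [hv i, mul_nonneg (neg_nonneg.2 hi) hθ]
    · have := hr.2 i (Finset.mem_filter.2 ⟨Finset.mem_univ i, hi⟩)
      rw [le_div_iff₀ hi] at this
      linarith

theorem lhs_values {β : Fin n → LemkeVar n} (h : IsUnit (basisMatrix A d β).det) :
    lhs A d (extend β (values A q d β)) = q := by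
  rw [lhs_extend, values, Matrix.mulVec_mulVec, Matrix.mul_nonsing_inv _ h, Matrix.one_mulVec]

theorem zPart_mem_SOL {β : Fin n → LemkeVar n} (h : IsUnit (basisMatrix A d β).det)
    (hv : ∀ i, 0 ≤ values A q d β i) (h0 : LemkeVar.z0 ∉ Set.range β)
    (hc : ∀ i, LemkeVar.z i ∈ Set.range β → LemkeVar.w i ∉ Set.range β) :
    zPart A q d β ∈ SOL q A := by
  have hw : ∀ i, (q + A.mulVec (zPart A q d β)) i = extend β (values A q d β) (.w i) := by
    intro i
    have := congrFun (lhs_values (q := q) h) i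
    rw [lhs, extend_of_notMem _ h0, ← zPart_eq] at this
    rw [Pi.add_apply]
    linarith
  refine ⟨⟨fun i => ?_, fun i => ?_⟩, Finset.sum_eq_zero fun i _ => ?_⟩
  · exact extend_nonneg hv _
  · rw [hw]
    exact extend_nonneg hv _
  · rw [hw, zPart_eq]
    by_cases hz : LemkeVar.z i ∈ Set.range β
    · rw [extend_of_notMem _ (hc i hz), mul_zero]
    · simp only [extend_of_notMem _ hz, zero_mul]

theorem Valid.compl_notMem_insert {β : Fin n → LemkeVar n} {e : LemkeVar n}
    (h : Valid A q d β e) {l v : LemkeVar n} (hv : v ∈ insert e (Set.range β \ {l}))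
    (hv0 : v ≠ .z0) : v.compl ∉ insert e (Set.range β \ {l}) := by
  rcases hv with rfl | hv
  · rintro (h' | h')
    exacts [LemkeVar.compl_ne_self hv0 h', h.compl_notMem h'.1]
  · rintro (h' | h')
    · refine h.compl_notMem ?_
      rw [← h', LemkeVar.compl_compl]
      exact hv.1
    · exact h.compl_mem v hv.1 hv0 h'.1

theorem step_spec {β : Fin n → LemkeVar n} {e : LemkeVar n} (h : Valid A q d β e) :
    (∃ z ∈ SOL q A, step A q d (.running β e) = .solved z) ∨
    (∃ β' e', step A q d (.running β e) = .running β' e' ∧ Valid A q d β' e' ∧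
      Pivots (Set.range β) e (Set.range β') e') ∨
    (step A q d (.running β e) = .ray ∧ ∀ i, rates A d β e i ≤ 0) := by
  classical
  by_cases hs : (candidates A d β e).Nonempty
  swap
  · right; right
    refine ⟨by rw [step, dif_neg hs], fun i => ?_⟩
    by_contra hi
    exact hs ⟨i, Finset.mem_filter.2 ⟨Finset.mem_univ i, not_le.1 hi⟩⟩
  have hinj := injective_of_isUnit h.lexFeasible.1
  have hblock : IsBlocking A q d β e (leavingRow A q d β e hs) := by
    rw [leavingRow]
    split_ifs with h'
    exacts [h'.choose_spec.1, isBlocking_lexArgmin hs]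
  have hrate := (Finset.mem_filter.1 hblock.1).2
  have hstep : step A q d (.running β e) =
      if β (leavingRow A q d β e hs) = .z0 then
        .solved (zPart A q d (Function.update β (leavingRow A q d β e hs) e))
      else .running (Function.update β (leavingRow A q d β e hs) e)
        (β (leavingRow A q d β e hs)).compl := by
    rw [step, dif_pos hs]
  by_cases hz : β (leavingRow A q d β e hs) = .z0
  · left
    rw [hstep, if_pos hz]
    refine ⟨_, zPart_mem_SOL (update_isUnit_and_tableau (q := q) h.lexFeasible.1 hrate.ne').1
      (values_update_nonneg h.lexFeasible hblock) ?_ ?_, rfl⟩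
    · rw [range_update hinj, hz]
      rintro (h' | h')
      exacts [h.entering_ne h'.symm, h'.2 rfl]
    · rw [range_update hinj]
      exact fun i hi => h.compl_notMem_insert hi (by simp)
  · right; left
    rw [hstep, if_neg hz]
    have hnot : ¬ ∃ r, IsBlocking A q d β e r ∧ β r = .z0 := by
      intro h'
      apply hz
      rw [leavingRow, dif_pos h']
      exact h'.choose_spec.2
    have hrow : leavingRow A q d β e hs =
        lexArgmin (candidates A d β e) hs (lexRatio A q d β e) := by
      rw [leavingRow, dif_neg hnot]
    have hrange := range_update hinj (leavingRow A q d β e hs) e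
    have hfeas : LexFeasible A q d (Function.update β (leavingRow A q d β e hs) e) := by
      rw [hrow]
      exact h.lexFeasible.update hs
    generalize leavingRow A q d β e hs = r at *
    have hzr : β r ∈ Set.range β := ⟨r, rfl⟩
    refine ⟨_, _, rfl, ⟨hfeas, ?_, fun j hj => ?_, ?_, ?_, ?_, ?_⟩, ⟨?_, ?_⟩⟩
    · rw [hrange]
      exact Or.inr ⟨h.z0_mem, fun h' => hz h'.symm⟩
    · have hjr : j ≠ r := by
        rintro rfl
        rw [Function.update_self] at hj
        exact h.entering_ne hj
      rw [Function.update_of_ne hjr] at hj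
      have hpos := h.values_pos j hj
      have hθ : 0 ≤ values A q d β r / rates A d β e r :=
        div_nonneg (h.lexFeasible.2 r).zero_le hrate.le
      rw [← tableau_zero, (update_isUnit_and_tableau h.lexFeasible.1 hrate.ne').2,
        pivot_of_ne _ _ hjr]
      show 0 < values A q d β j - rates A d β e j * ((rates A d β e r)⁻¹ * values A q d β r)
      rw [← div_eq_inv_mul]
      rcases le_or_gt (rates A d β e j) 0 with hi | hi
      · linarith [mul_nonneg (neg_nonneg.2 hi) hθ]
      · have hle := hblock.2 j (Finset.mem_filter.2 ⟨Finset.mem_univ j, hi⟩)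
        have hlt : values A q d β r / rates A d β e r < values A q d β j / rates A d β e j := by
          -- A tie would make the row of `z₀` blocking, and then `z₀` would have left. So `z₀` stays
          -- strictly positive.
          refine lt_of_le_of_ne hle fun heq => hnot ⟨j, ⟨?_, fun i hi' => ?_⟩, hj⟩
          · exact Finset.mem_filter.2 ⟨Finset.mem_univ j, hi⟩
          · rw [← heq]
            exact hblock.2 i hi'
        rw [lt_div_iff₀ hi] at hlt
        linarith
    · rwa [Ne, LemkeVar.compl_eq_z0]
    · rw [hrange]
      rintro (h' | h')
      · exact h.compl_notMem (by rw [← h', LemkeVar.compl_compl]; exact hzr)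
      · exact h.compl_mem _ hzr hz h'.1
    · rw [hrange, LemkeVar.compl_compl]
      rintro (h' | h')
      · exact h.entering_notMem (h' ▸ hzr)
      · exact h'.2 rfl
    · rw [hrange]
      exact fun v hv hv0 => h.compl_notMem_insert hv hv0
    · rw [LemkeVar.compl_compl]
      exact hzr
    · rw [hrange, LemkeVar.compl_compl]

/-! ### Rays and infeasibility -/

/-- A secondary ray `x + t y` along which complementarity holds and some `zᵢ` increases
certifies that `FEA(q, A)` is empty. -/
theorem FEA_eq_empty_of_ray (hA : IsSemimonotoneStarTilde A) (hd : ∀ i, 0 < d i)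
    {x y : LemkeVar n → ℝ} (hx : lhs A d x = q) (hy : lhs A d y = 0) (hx0 : 0 < x .z0)
    (hy0 : ∀ v, 0 ≤ y v) (hyz : ∃ i, y (.z i) ≠ 0)
    (hyy : ∀ i, y (.z i) * y (.w i) = 0) (hyx : ∀ i, y (.z i) * x (.w i) = 0)
    (hxy : ∀ i, x (.z i) * y (.w i) = 0) : FEA q A = ∅ := by
  obtain ⟨⟨hE0, hstar⟩, htilde⟩ := hA
  set u : Fin n → ℝ := fun i => y (.z i) with hu
  set v : Fin n → ℝ := fun i => x (.z i) with hv
  have hu0 : 0 ≤ u := fun i => hy0 _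
  have hune : u ≠ 0 := fun h => hyz.elim fun i hi => hi (congrFun h i)
  have hyi : ∀ i, y (.w i) - A.mulVec u i - d i * y .z0 = 0 := fun i => congrFun hy i
  have hxi : ∀ i, x (.w i) - A.mulVec v i - d i * x .z0 = q i := fun i => congrFun hx i
  -- At the index given by semimonotonicity the slack of `y` vanishes, so `(A u)ᵢ + dᵢ y_{z₀} = 0`
  -- is a sum of nonnegative terms.
  have hz0 : y .z0 = 0 := by
    obtain ⟨i, hi, hAi⟩ := hE0 u hu0 hune
    have hwi : y (.w i) = 0 := (mul_eq_zero.1 (hyy i)).resolve_left hi.ne'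
    have h1 := hyi i
    have h2 := mul_nonneg (hd i).le (hy0 .z0)
    have h3 : d i * y .z0 = 0 := by linarith
    exact (mul_eq_zero.1 h3).resolve_left (hd i).ne'
  have hAu : ∀ i, A.mulVec u i = y (.w i) := fun i => by
    have := hyi i
    rw [hz0, mul_zero] at this
    linarith
  have hAu0 : 0 ≤ A.mulVec u := fun i => by
    rw [hAu]
    exact hy0 _
  have huAu : u ⬝ᵥ A.mulVec u = 0 := Finset.sum_eq_zero fun i _ => by rw [hAu]; exact hyy i
  have hAt := hstar u huAu hAu0 hu0
  have hSOL : u ∈ SOL 0 A := ⟨⟨hu0, by rwa [zero_add]⟩, by rwa [zero_add]⟩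
  -- Where `(Aᵀu)ᵢ ≠ 0`, the tilde condition makes the slack `(A u)ᵢ` of `y` nonzero, and
  -- complementarity gives `vᵢ = 0`.
  have hvA : v ⬝ᵥ A.transpose.mulVec u = 0 := Finset.sum_eq_zero fun i _ => by
    by_cases h : A.transpose.mulVec u i = 0
    · rw [h, mul_zero]
    · have := htilde u hSOL i h
      rw [hAu] at this
      rw [hv]
      simp only
      rw [(mul_eq_zero.1 (hxy i)).resolve_right this, zero_mul]
  have htrans : ∀ p : Fin n → ℝ, u ⬝ᵥ A.mulVec p = p ⬝ᵥ A.transpose.mulVec u := by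
    intro p
    rw [Matrix.dotProduct_mulVec, Matrix.mulVec_transpose, dotProduct_comm]
  have hdu : 0 < u ⬝ᵥ d := by
    obtain ⟨i, hi⟩ := hyz
    exact Finset.sum_pos' (fun j _ => mul_nonneg (hu0 j) (hd j).le)
      ⟨i, Finset.mem_univ i, mul_pos (lt_of_le_of_ne (hu0 i) (Ne.symm hi)) (hd i)⟩
  have hqu : u ⬝ᵥ q = -(u ⬝ᵥ d * x .z0) := by
    have h1 : u ⬝ᵥ q = ∑ i, (u i * x (.w i) - u i * A.mulVec v i - u i * d i * x .z0) :=
      Finset.sum_congr rfl fun i _ => by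
        rw [← hxi i]
        ring
    rw [h1, Finset.sum_sub_distrib, Finset.sum_sub_distrib, ← Finset.sum_mul,
      Finset.sum_eq_zero fun i _ => hyx i]
    have h2 : ∑ i, u i * A.mulVec v i = 0 := (htrans v).trans hvA
    rw [h2, sub_zero, zero_sub]
    rfl
  refine Set.eq_empty_of_forall_notMem fun p hp => ?_
  have h1 : 0 ≤ u ⬝ᵥ (q + A.mulVec p) := dotProduct_nonneg_of_nonneg hu0 hp.2
  rw [dotProduct_add, htrans, hqu] at h1
  have h2 : 0 ≤ p ⬝ᵥ -A.transpose.mulVec u :=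
    dotProduct_nonneg_of_nonneg hp.1 (neg_nonneg.2 hAt)
  rw [dotProduct_neg] at h2
  linarith [mul_pos hdu hx0]

-- The second alternative is the primary ray, along which only `z₀` and the slacks grow.
open Classical in
theorem ray_spec (hA : IsSemimonotoneStarTilde A) (hd : ∀ i, 0 < d i)
    {β : Fin n → LemkeVar n} {e : LemkeVar n} (h : Valid A q d β e)
    (hr : ∀ i, rates A d β e i ≤ 0) :
    FEA q A = ∅ ∨ ∃ i, e = .w i ∧ Set.range β = initialBasis i := by
  have hinj := injective_of_isUnit h.lexFeasible.1
  set x := extend β (values A q d β) with hx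
  set y : LemkeVar n → ℝ := Pi.single e 1 - extend β (rates A d β e) with hy
  have hx0 : ∀ v, 0 ≤ x v := extend_nonneg fun j => (h.lexFeasible.2 j).zero_le
  have hye : y e = 1 := by
    simp [hy, extend_of_notMem _ h.entering_notMem]
  have hy_ne : ∀ v, v ≠ e → y v = -extend β (rates A d β e) v := fun v hv => by
    simp [hy, hv]
  have hy0 : ∀ v, 0 ≤ y v := by
    intro v
    by_cases hv : v = e
    · rw [hv, hye]
      exact zero_le_one
    · rw [hy_ne v hv]
      by_cases hvβ : v ∈ Set.range β
      · obtain ⟨j, rfl⟩ := hvβ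
        rw [extend_apply hinj]
        exact neg_nonneg.2 (hr j)
      · rw [extend_of_notMem _ hvβ, neg_zero]
  have hyout : ∀ v, v ∉ Set.range β → v ≠ e → y v = 0 := fun v hv hve => by
    rw [hy_ne v hve, extend_of_notMem _ hv, neg_zero]
  have hxout : ∀ v, v ∉ Set.range β → x v = 0 := fun v hv => extend_of_notMem _ hv
  have hylhs : lhs A d y = 0 := by
    rw [hy, lhs_sub, lhs_extend, basisMatrix_mulVec_rates h.lexFeasible.1, sub_eq_zero]
    ext i
    simp [lhs_eq_sum, Pi.single_apply]
  -- Both the point and the direction are supported on the basis and `e`, which together contain at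
  -- most one variable of each complementary pair.
  have hcompl : ∀ v, v ≠ .z0 → v.compl ∉ Set.range β ∧ v.compl ≠ e ∨
      v ∉ Set.range β ∧ v ≠ e := by
    intro v hv
    by_cases hve : v = e
    · left
      rw [hve]
      exact ⟨h.compl_notMem, LemkeVar.compl_ne_self h.entering_ne⟩
    by_cases hve' : v.compl = e
    · right
      refine ⟨fun h' => h.compl_notMem ?_, hve⟩
      rw [← hve', LemkeVar.compl_compl]
      exact h'
    by_cases hvβ : v ∈ Set.range β
    · exact Or.inl ⟨h.compl_mem v hvβ hv, hve'⟩
    · exact Or.inr ⟨hvβ, hve⟩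
  have hprod : ∀ {a b : LemkeVar n → ℝ}, (∀ v, v ∉ Set.range β → v ≠ e → a v = 0) →
      (∀ v, v ∉ Set.range β → v ≠ e → b v = 0) → ∀ i, a (.z i) * b (.w i) = 0 := by
    intro a b ha hb i
    rcases hcompl (.z i) (by simp) with h' | h'
    · rw [show b (.w i) = 0 from hb _ h'.1 h'.2, mul_zero]
    · rw [ha _ h'.1 h'.2, zero_mul]
  have hxout' : ∀ v, v ∉ Set.range β → v ≠ e → x v = 0 := fun v hv _ => hxout v hv
  by_cases hyz : ∃ i, y (.z i) ≠ 0
  · left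
    refine FEA_eq_empty_of_ray hA hd (lhs_values h.lexFeasible.1) hylhs ?_ hy0 hyz
      (hprod hyout hyout) (hprod hyout hxout') (hprod hxout' hyout)
    obtain ⟨j, hj⟩ := h.z0_mem
    have := h.values_pos j hj
    rw [← hj, extend_apply hinj]
    exact this
  · right
    push Not at hyz
    have hz : (fun j => y (.z j)) = 0 := funext hyz
    have hyw : ∀ i, y (.w i) = d i * y .z0 := fun i => by
      have := congrFun hylhs i
      rw [lhs, hz, Matrix.mulVec_zero] at this
      simpa [sub_eq_zero] using this
    rcases e with _ | i | i
    · exact absurd rfl h.entering_ne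
    swap
    · rw [hyz] at hye
      exact absurd hye zero_ne_one
    refine ⟨i, rfl, ?_⟩
    have hz0 : y .z0 ≠ 0 := fun h0 => by
      rw [hyw, h0, mul_zero] at hye
      exact zero_ne_one hye
    -- Every slack grows at the positive rate `d k * y .z0`, so each one other than the entering `w
    -- i` must be basic.
    have hwmem : ∀ k, k ≠ i → LemkeVar.w k ∈ Set.range β := by
      intro k hk
      by_contra hkβ
      have := hyout _ hkβ (by simpa using hk)
      rw [hyw] at this
      exact mul_ne_zero (hd k).ne' hz0 this
    ext v
    rcases v with _ | k | k
    · exact iff_of_true h.z0_mem (Set.mem_insert _ _)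
    · rw [w_mem_initialBasis]
      refine ⟨?_, hwmem k⟩
      rintro hk rfl
      exact h.entering_notMem hk
    · refine iff_of_false ?_ z_notMem_initialBasis
      by_cases hk : k = i
      · subst hk
        exact h.compl_notMem
      · exact h.compl_mem _ (hwmem k hk) (by simp)

/-! ### Termination and conclusion -/

theorem exists_isPath (A : Matrix (Fin n) (Fin n) ℝ) {r : Fin n} {β₀ : Fin n → LemkeVar n}
    (hβ₀ : Set.range β₀ = initialBasis r) (hv : Valid A q d β₀ (.z r)) :
    ∃ (β : ℕ → Fin n → LemkeVar n) (e : ℕ → LemkeVar n), ∀ m : ℕ,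
      (∀ k < m, ∃ β' e', (step A q d)^[k + 1] (.running β₀ (.z r)) = .running β' e') →
        IsPath A q d r β e m ∧
          (step A q d)^[m] (.running β₀ (.z r)) = .running (β m) (e m) := by
  have hdata : ∀ k, ∃ p : (Fin n → LemkeVar n) × LemkeVar n,
      (∃ β' e', (step A q d)^[k] (.running β₀ (.z r)) = .running β' e') →
        (step A q d)^[k] (.running β₀ (.z r)) = .running p.1 p.2 := by
    intro k
    by_cases h : ∃ β' e', (step A q d)^[k] (.running β₀ (.z r)) = .running β' e'
    · obtain ⟨β', e', h'⟩ := h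
      exact ⟨(β', e'), fun _ => h'⟩
    -- An arbitrary value for the times after the run has stopped.
    · exact ⟨(β₀, .z r), fun h' => absurd h' h⟩
  choose p hp using hdata
  refine ⟨fun k => (p k).1, fun k => (p k).2, fun m => ?_⟩
  induction m with
  | zero =>
    intro _
    have h0 := hp 0 ⟨_, _, rfl⟩
    simp only [Function.iterate_zero, id, LemkeConfig.running.injEq] at h0
    refine ⟨⟨by rw [← h0.1, hβ₀], h0.2.symm, fun k hk => ?_, fun k hk => by omega⟩,
      hp 0 ⟨_, _, rfl⟩⟩
    rw [Nat.le_zero.1 hk, ← h0.1, ← h0.2]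
    exact hv
  | succ m ih =>
    intro h
    obtain ⟨hpath, hm⟩ := ih fun k hk => h k (by omega)
    have hm1 := hp (m + 1) (h m (by omega))
    refine ⟨?_, hm1⟩
    have hstep := hm1
    rw [Function.iterate_succ_apply', hm] at hstep
    rcases step_spec (hpath.valid m le_rfl) with ⟨z, -, hz⟩ | ⟨β', e', hs, hv', hpiv⟩ | ⟨hray, -⟩
    · rw [hz] at hstep
      cases hstep
    · rw [hs] at hstep
      obtain ⟨rfl, rfl⟩ := LemkeConfig.running.inj hstep
      refine ⟨hpath.range_zero, hpath.entering_zero, fun k hk => ?_, fun k hk => ?_⟩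
      · rcases Nat.le_succ_iff.1 hk with hk' | rfl
        exacts [hpath.valid k hk', hv']
      · rcases Nat.lt_succ_iff_lt_or_eq.1 hk with hk' | rfl
        exacts [hpath.pivots k hk', hpiv]
    · rw [hray] at hstep
      cases hstep

/-- Lemke's algorithm processes `LCP(q, A)` for every `Ẽ₀ˢ`-matrix `A`. -/
theorem processes_of_isSemimonotoneStarTilde (hA : IsSemimonotoneStarTilde A) (q : Fin n → ℝ) :
    Processes A q := by
  intro d hd
  by_cases hq : 0 ≤ q
  · refine ⟨0, Or.inl ⟨0, ⟨⟨le_rfl, by simpa using hq⟩, by simp⟩, ?_⟩⟩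
    rw [Function.iterate_zero, id, start, dif_pos hq]
  obtain ⟨r, β₀, hstart, hrange, hvalid⟩ := start_spec A hd hq
  rw [hstart]
  obtain ⟨β, e, hpath⟩ := exists_isPath A hrange hvalid
  obtain ⟨m, hm, hlt⟩ : ∃ m,
      (¬ ∃ β' e', (step A q d)^[m + 1] (.running β₀ (.z r)) = .running β' e') ∧
      ∀ k < m, ∃ β' e', (step A q d)^[k + 1] (.running β₀ (.z r)) = .running β' e' := by
    classical
    have hex : ∃ m, ¬ ∃ β' e', (step A q d)^[m + 1] (.running β₀ (.z r)) = .running β' e' := by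
      by_contra! hall
      obtain ⟨i, j, hij, heq⟩ := Finite.exists_ne_map_eq_of_infinite fun k => (β k, e k)
      obtain ⟨hβ, he⟩ := Prod.mk.inj heq
      rcases lt_or_gt_of_ne hij with h | h
      · exact (hpath j fun k _ => hall k).1.ne_of_lt hd h le_rfl (by rw [hβ]) he
      · exact (hpath i fun k _ => hall k).1.ne_of_lt hd h le_rfl (by rw [hβ]) he.symm
    exact ⟨Nat.find hex, Nat.find_spec hex, fun k hk => not_not.1 (Nat.find_min hex hk)⟩
  obtain ⟨hP, hrun⟩ := hpath m hlt
  refine ⟨m + 1, ?_⟩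
  rw [Function.iterate_succ_apply', hrun] at hm ⊢
  rcases step_spec (hP.valid m le_rfl) with hz | ⟨β', e', hs, -⟩ | ⟨hray, hrates⟩
  · exact Or.inl hz
  · exact absurd ⟨β', e', hs⟩ hm
  · refine Or.inr ⟨hray, ?_⟩
    rcases ray_spec hA hd (hP.valid m le_rfl) hrates with hF | ⟨i, hei, hi⟩
    · exact hF
    · have h1 := (hP.valid m le_rfl).lexFeasible.isLexBasis
      have h2 := (hP.valid 0 (Nat.zero_le m)).lexFeasible.isLexBasis
      rw [hi] at h1
      rw [hP.range_zero] at h2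
      have hir := initialBasis_unique hd h1 h2
      -- On the primary ray the basis is again the initial one and `w r` enters, the complement of
      -- the first entering variable.
      refine (hP.not_reversed (by rw [hi, hP.range_zero, hir]) ?_).elim
      rw [hei, hP.entering_zero, hir]
      rfl

end Lemke

end LCP

theorem mainTheorem2 {n : ℕ} (A : Matrix (Fin n) (Fin n) ℝ)
    (hA : LCP.IsSemimonotoneStarTilde A)
    (hPPT : ∀ M : Matrix (Fin n) (Fin n) ℝ, LCP.IsLegitimatePPT A M →
      LCP.IsAlmostStrictlySemimonotone M ∨ LCP.IsCompletelySemimonotoneStarTilde M)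
    (q : Fin n → ℝ) :
    LCP.Lemke.Processes A q :=
  LCP.Lemke.processes_of_isSemimonotoneStarTilde hA q
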